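/- Let $X$ be a real Banach space with dual $X^*$. A sequence of pairs $(x_n,x_n^*)_{n\ge1}$ in $X\times X^*$ is a *biorthogonal system* if $x_n^*(x_m)=\delta_{nm}$; it is a *$wc_0^*$-biorthogonal system* if moreover $(x_n^*)$ is bounded, bounded away from $0$ in norm, and weakly null in $X^*$ (i.e. $x^{**}(x_n^*)\to0$ for all $x^{**}\in X^{**}$). It is *$M$-bounded* if $(x_n)$ and $(x_n^*)$ are bounded and $\sup_n\|x_n\|\,\|x_n^*\|\le M$, and *bounded* if it is $M$-bounded for some finite $M$. It is *fundamental* if the closed linear span of $\{x_n\}$ is $X$, and *total* if the weak$^*$-closure of the linear span of $\{x_n^*\}$ is $X^*$. A Banach space has the *Schur property* if weak and norm convergence of sequences coincide in it. The following are equivalent: (a) $X^*$ fails the Schur property; (b) there is a bounded $wc_0^*$-biorthogonal system in $X\times X^*$. If $X$ is separable, (a) and (b) are also equivalent to (c) there is a bounded fundamental total $wc_0^*$-biorthogonal system in $X\times X^*$. Furthermore, for each $\varepsilon>0$: if (b) holds, then there is a $(1+\varepsilon)$-bounded $wc_0^*$-biorthogonal system in $X\times X^*$; if $X$ is separable and (c)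 holds, then there is a $[2(1+\sqrt2)^2+\varepsilon]$-bounded fundamental total $wc_0^*$-biorthogonal system $(x_n,x_n^*)$ in $X\times X^*$ such that the closed linear span $Z=[x_n^*]$ norms $X$, i.e. $\|x\|\le\sup_{z\in Z\setminus\{0\}} z(x)/\|z\|$ for every $x\in X$. -/

import Mathlib

open Filter Topology

/-- Weak convergence of a sequence in a real normed space. -/
def WeaklyTendsto {Z : Type*} [NormedAddCommGroup Z] [NormedSpace ℝ Z]
    (z : ℕ → Z) (l : Z) : Prop :=
  Tendsto (fun n => toWeakSpace ℝ Z (z n)) atTop (𝓝 (toWeakSpace ℝ Z l))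

/-- The Schur property: weak and norm convergence of sequences coincide. -/
def SchurProperty (Z : Type*) [NormedAddCommGroup Z] [NormedSpace ℝ Z] : Prop :=
  ∀ (z : ℕ → Z) (l : Z), WeaklyTendsto z l ↔ Tendsto z atTop (𝓝 l)

/-- Bounded and bounded away from zero. -/
def SemiNormalized {Z : Type*} [NormedAddCommGroup Z] (z : ℕ → Z) : Prop :=
  ∃ c C : ℝ, 0 < c ∧ ∀ n, c ≤ ‖z n‖ ∧ ‖z n‖ ≤ C

/-- A set of vectors is fundamental if its closed linear span is the whole space. -/
def IsFundamentalSet {X : Type*} [NormedAddCommGroup X] [NormedSpace ℝ X] (S : Set X) : Prop :=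
  (Submodule.span ℝ S).topologicalClosure = ⊤

/-- A set of functionals is total if the weak-star closure of its linear span is the dual. -/
def IsTotalSet {X : Type*} [NormedAddCommGroup X] [NormedSpace ℝ X]
    (Z : Set (StrongDual ℝ X)) : Prop :=
  closure (StrongDual.toWeakDual '' (Submodule.span ℝ Z : Set (StrongDual ℝ X))) = Set.univ

/-- `Z` `τ`-norms `S`: `‖x‖ ≤ τ * sup {z x / ‖z‖ : z ∈ Z, z ≠ 0}` for all `x ∈ S`.
The supremum is over a set bounded above by `‖x‖`. -/
def TauNorms {X : Type*} [NormedAddCommGroup X] [NormedSpace ℝ X]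
    (τ : ℝ) (Z : Set (StrongDual ℝ X)) (S : Set X) : Prop :=
  ∀ x ∈ S, ‖x‖ ≤ τ * ⨆ z : ↥(Z \ {0}), z.1 x / ‖z.1‖

/-- `Z` norms `S` if it `1`-norms `S`. -/
def Norms {X : Type*} [NormedAddCommGroup X] [NormedSpace ℝ X]
    (Z : Set (StrongDual ℝ X)) (S : Set X) : Prop :=
  TauNorms 1 Z S

namespace Biorth

variable {X : Type*} [NormedAddCommGroup X] [NormedSpace ℝ X]

/-- `(x n, f n)` is a biorthogonal system. -/
def IsSystem (x : ℕ → X) (f : ℕ → StrongDual ℝ X) : Prop :=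
  ∀ n m, f n (x m) = if n = m then 1 else 0

/-- A biorthogonal system whose functionals form a semi-normalized weakly null
sequence in the dual (weak topology induced by the bidual). -/
def IsWC0Star (x : ℕ → X) (f : ℕ → StrongDual ℝ X) : Prop :=
  IsSystem x f ∧ SemiNormalized f ∧ WeaklyTendsto f 0

/-- `M`-boundedness of a system. -/
def IsMBounded (M : ℝ) (x : ℕ → X) (f : ℕ → StrongDual ℝ X) : Prop :=
  Bornology.IsBounded (Set.range x) ∧ Bornology.IsBounded (Set.range f) ∧
    ∀ n, ‖x n‖ * ‖f n‖ ≤ M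

/-- A system is bounded if it is `M`-bounded for some finite `M`. -/
def IsBounded (x : ℕ → X) (f : ℕ → StrongDual ℝ X) : Prop :=
  ∃ M : ℝ, IsMBounded M x f

/-- There is a bounded `wc₀*`-biorthogonal system in `X × X*`. -/
def HasBoundedWC0Star (X : Type*) [NormedAddCommGroup X] [NormedSpace ℝ X] : Prop :=
  ∃ (x : ℕ → X) (f : ℕ → StrongDual ℝ X), IsWC0Star x f ∧ IsBounded x f

/-- There is a bounded fundamental total `wc₀*`-biorthogonal system in `X × X*`. -/
def HasBoundedFTWC0Star (X : Type*) [NormedAddCommGroup X] [NormedSpace ℝ X] : Prop :=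
  ∃ (x : ℕ → X) (f : ℕ → StrongDual ℝ X), IsWC0Star x f ∧ IsBounded x f ∧
    IsFundamentalSet (Set.range x) ∧ IsTotalSet (Set.range f)

end Biorth

/-! ### Weak convergence -/

/-! Everything starts from failure of the Schur property, which supplies norm-one functionals `f k`
tending weakly to zero. Conversely, the functionals of any `wc₀*`-system are weakly null without
being norm null, so (b) and (c) give (a) at once.

A finite biorthogonal system defines the projection `P = ∑ s_j^* ⊗ s_j`. A further pair is obtained
by applying `1 - P` to vectors (`vecRes`) and its adjoint to functionals (`dualRes`). Weak-star
nullity makes `dualRes (f k)` asymptotic to `f k`, so the functionals cost almost nothing; the issue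
is the norm of the vectors.

For `1 + ε`, choose unit-ball vectors `y k` almost norming `f k`, with weak-star limit `Y` in the
bidual along an ultrafilter. The correction `P (y k)` is asymptotically bounded by `∑ |Y s_j^*|
‖s_j‖`. Since `Y (f k) → 0`, by nullity against the whole bidual, the functionals can be chosen to
keep this sum below `δ` forever.

For the fundamental total system, some steps must absorb a dense sequence and functionals norming
it, with no norm control. These go to odd indices. At even indices a compactness argument gives
vectors of norm about `2` and functionals of norm about `1`. Each odd term is then mixed with a
finite block of even terms by an orthogonal Haar matrix. Orthogonality preserves biorthogonality and
spans, the tiny constant column suppresses the odd term, and row sums below `1 + √2` multiply each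
bound by that factor, whence `2(1 + √2)²`. -/

theorem weaklyTendsto_iff {Z : Type*} [NormedAddCommGroup Z] [NormedSpace ℝ Z] {z : ℕ → Z} {l : Z} :
    WeaklyTendsto z l ↔ ∀ φ : StrongDual ℝ Z, Tendsto (fun n => φ (z n)) atTop (𝓝 (φ l)) := by
  refine WeakBilin.tendsto_iff_forall_eval_tendsto (topDualPairing ℝ Z).flip ?_
  intro x y hxy
  rw [SeparatingDual.eq_iff_forall_dual_eq (R := ℝ)]
  intro φ
  exact DFunLike.congr_fun hxy φ

theorem Filter.Tendsto.weaklyTendsto {Z : Type*} [NormedAddCommGroup Z] [NormedSpace ℝ Z]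
    {z : ℕ → Z} {l : Z} (h : Tendsto z atTop (𝓝 l)) : WeaklyTendsto z l :=
  weaklyTendsto_iff.2 fun φ => (φ.continuous.tendsto l).comp h

/-- Norm convergence always implies weak convergence, so failure means a weakly convergent sequence
that is not norm convergent. A subsequence stays at distance `ε` from the limit, and dividing the
differences by their norms preserves weak nullity. -/
theorem exists_normalized_weaklyTendsto_zero_of_not_schurProperty {Z : Type*}
    [NormedAddCommGroup Z] [NormedSpace ℝ Z] (h : ¬ SchurProperty Z) :
    ∃ z : ℕ → Z, (∀ n, ‖z n‖ = 1) ∧ WeaklyTendsto z 0 := by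
  simp only [SchurProperty, not_forall] at h
  obtain ⟨z, l, h⟩ := h
  have hw : WeaklyTendsto z l := by
    by_contra hw
    exact h ⟨fun h' => absurd h' hw, fun h' => h'.weaklyTendsto⟩
  have hn : ¬ Tendsto z atTop (𝓝 l) := fun hn => h ⟨fun _ => hn, fun _ => hw⟩
  obtain ⟨ε, hε, hfreq⟩ : ∃ ε > 0, ∃ᶠ n in atTop, ε ≤ ‖z n - l‖ := by
    rw [tendsto_iff_norm_sub_tendsto_zero, Metric.tendsto_nhds] at hn
    push Not at hn
    obtain ⟨ε, hε, hf⟩ := hn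
    exact ⟨ε, hε, by simpa using hf⟩
  obtain ⟨k, hk, hkε⟩ := extraction_of_frequently_atTop hfreq
  have hpos : ∀ n, 0 < ‖z (k n) - l‖ := fun n => hε.trans_le (hkε n)
  refine ⟨fun n => ‖z (k n) - l‖⁻¹ • (z (k n) - l), fun n => ?_, weaklyTendsto_iff.2 fun φ => ?_⟩
  · rw [norm_smul, norm_inv, norm_norm, inv_mul_cancel₀ (hpos n).ne']
  · have h0 : Tendsto (fun n => ε⁻¹ * ‖φ (z (k n)) - φ l‖) atTop (𝓝 0) := by
      have := ((weaklyTendsto_iff.1 hw φ).comp hk.tendsto_atTop)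
      rw [tendsto_iff_norm_sub_tendsto_zero] at this
      simpa using this.const_mul ε⁻¹
    rw [map_zero]
    refine squeeze_zero_norm (fun n => ?_) h0
    rw [map_smul, map_sub, norm_smul, norm_inv, norm_norm]
    gcongr
    exact hkε n

theorem not_schurProperty_of_semiNormalized {Z : Type*} [NormedAddCommGroup Z] [NormedSpace ℝ Z]
    {z : ℕ → Z} (hz : SemiNormalized z) (hw : WeaklyTendsto z 0) : ¬ SchurProperty Z := by
  intro h
  obtain ⟨c, C, hc, hz⟩ := hz
  have h0 : Tendsto (fun n => ‖z n‖) atTop (𝓝 0) := by simpa using ((h z 0).1 hw).norm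
  exact absurd (ge_of_tendsto' h0 fun n => (hz n).1) (not_le.2 hc)

/-- A sequence asymptotic to elements of a weakly null sequence with indices tending to infinity
is weakly null. -/
theorem WeaklyTendsto.of_norm_sub_le {Z : Type*} [NormedAddCommGroup Z] [NormedSpace ℝ Z]
    {f h : ℕ → Z} (hf : WeaklyTendsto f 0)
    (hh : ∀ n : ℕ, ∃ k, n ≤ k ∧ ‖h n - f k‖ ≤ 1 / ((n : ℝ) + 1)) : WeaklyTendsto h 0 := by
  choose k hk hkn using hh
  refine weaklyTendsto_iff.2 fun φ => ?_
  have hk' : Tendsto k atTop atTop := tendsto_atTop_mono hk tendsto_id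
  have h1 : Tendsto (fun n => h n - f (k n)) atTop (𝓝 0) :=
    squeeze_zero_norm hkn tendsto_one_div_add_atTop_nhds_zero_nat
  have h2 := ((φ.continuous.tendsto 0).comp h1).add ((weaklyTendsto_iff.1 hf φ).comp hk')
  simpa [Function.comp_def] using h2

/-! ### Recursive constructions -/

/-- If every finite initial segment satisfying the conditions `R i` can be prolonged, there is an
infinite sequence satisfying all of them. -/
theorem exists_seq_of_step {α : Type*} [Nonempty α] (R : ℕ → (ℕ → α) → Prop)
    (hR : ∀ i s t, (∀ j ≤ i, s j = t j) → R i s → R i t)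
    (step : ∀ n s, (∀ i < n, R i s) → ∃ a, R n (Function.update s n a)) :
    ∃ s, ∀ i, R i s := by
  classical
  obtain ⟨a₀⟩ := ‹Nonempty α›
  choose! a ha using step
  let S : ℕ → ℕ → α := fun n => Nat.rec (fun _ => a₀) (fun n s => Function.update s n (a n s)) n
  have hS : ∀ n, S (n + 1) = Function.update (S n) n (a n (S n)) := fun n => rfl
  have hstab : ∀ j n, j < n → S n j = S (j + 1) j := by
    intro j n hjn
    induction n, hjn using Nat.le_induction with
    | base => rfl
    | succ n hn ih => rw [hS, Function.update_of_ne (by omega), ih]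
  have hinv : ∀ n, ∀ i < n, R i (S n) := by
    intro n
    induction n with
    | zero => intro i hi; omega
    | succ n ih =>
      intro i hi
      rcases Nat.lt_succ_iff_lt_or_eq.1 hi with hi | rfl
      · refine hR i (S n) _ (fun j hj => ?_) (ih i hi)
        rw [hstab j n (by omega), hstab j (n + 1) (by omega)]
      · rw [hS]; exact ha i _ ih
  -- Entry `n` is fixed at stage `n + 1` and never changes again, so the diagonal agrees with every
  -- later stage.
  refine ⟨fun n => S (n + 1) n, fun i => ?_⟩
  exact hR i (S (i + 1)) _ (fun j hj => hstab j (i + 1) (Nat.lt_succ_of_le hj))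
    (hinv (i + 1) i (Nat.lt_succ_self i))

/-! ### Norming and total sets of functionals -/

/-- Weak-star continuous functionals on the dual are evaluations at points of `X`. By Hahn–Banach, a
proper weak-star closed subspace would be annihilated by a nonzero point. -/
theorem isTotalSet_of_separating {X : Type*} [NormedAddCommGroup X] [NormedSpace ℝ X]
    {Z : Set (StrongDual ℝ X)} (hZ : ∀ x, (∀ z ∈ Z, z x = 0) → x = 0) : IsTotalSet Z := by
  have : LocallyConvexSpace ℝ (WeakDual ℝ X) :=
    WeakBilin.locallyConvexSpace (B := topDualPairing ℝ X)
  let V : Submodule ℝ (WeakDual ℝ X) :=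
    (Submodule.span ℝ Z).map (StrongDual.toWeakDual (𝕜 := ℝ) (E := X)).toLinearMap
  have hV : V.topologicalClosure = ⊤ := by
    rw [eq_top_iff]
    intro φ _
    by_contra hφ
    obtain ⟨F, u, hF, hu⟩ := geometric_hahn_banach_closed_point V.topologicalClosure.convex
      V.isClosed_topologicalClosure hφ
    obtain ⟨x, rfl⟩ := LinearMap.dualEmbedding_surjective (topDualPairing ℝ X) F
    have hz : ∀ v ∈ V, v x = 0 := by
      intro v hv
      by_contra hvx
      -- A functional bounded above on a subspace vanishes there: this multiple of `v` would take
      -- the value `u + 1`.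
      have h1 := hF (((u + 1) / v x) • v)
        (V.le_topologicalClosure (V.smul_mem _ hv))
      change ((u + 1) / v x) * v x < u at h1
      rw [div_mul_cancel₀ _ hvx] at h1
      linarith
    have hx : x = 0 := hZ x fun z hz' =>
      hz (StrongDual.toWeakDual z) (Submodule.mem_map_of_mem (Submodule.subset_span hz'))
    have h0 := hF 0 (Submodule.zero_mem _)
    subst hx
    simp only [map_zero] at h0 hu
    exact lt_asymm h0 hu
  have := congrArg (fun W : Submodule ℝ (WeakDual ℝ X) => (W : Set (WeakDual ℝ X))) hV
  exact this

theorem norms_of_norm_one_sequence {X : Type*} [NormedAddCommGroup X] [NormedSpace ℝ X]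
    {d : ℕ → X} (hd : DenseRange d) {g : ℕ → StrongDual ℝ X} (hg : ∀ k, ‖g k‖ = 1)
    (hgd : ∀ k, g k (d k) = ‖d k‖) {Z : Set (StrongDual ℝ X)} (hZ : ∀ k, g k ∈ Z) :
    Norms Z Set.univ := by
  intro x _
  rw [one_mul]
  have hbdd : BddAbove (Set.range fun z : ↥(Z \ {0}) => z.1 x / ‖z.1‖) := by
    refine ⟨‖x‖, ?_⟩
    rintro _ ⟨z, rfl⟩
    have hz : 0 < ‖z.1‖ := norm_pos_iff.2 z.2.2
    change z.1 x / ‖z.1‖ ≤ ‖x‖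
    rw [div_le_iff₀ hz, mul_comm]
    exact (le_abs_self _).trans (z.1.le_opNorm x)
  -- For `d k` within `ε / 2` of `x`, `g k x ≥ ‖d k‖ - ‖x - d k‖ ≥ ‖x‖ - ε`.
  refine le_of_forall_pos_sub_le fun ε hε => ?_
  obtain ⟨k, hk⟩ := hd.exists_dist_lt x (half_pos hε)
  have hk0 : g k ≠ 0 := by
    intro h; simpa [h] using hg k
  refine le_trans ?_ (le_ciSup hbdd ⟨g k, hZ k, hk0⟩)
  simp only [hg, div_one]
  have h1 : |g k (x - d k)| ≤ ‖x - d k‖ := by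
    simpa [hg] using (g k).le_opNorm (x - d k)
  rw [map_sub, hgd] at h1
  have h2 := norm_sub_norm_le x (d k)
  rw [dist_eq_norm] at hk
  have := (abs_le.1 h1).1
  linarith

theorem eq_zero_of_norm_one_sequence {X : Type*} [NormedAddCommGroup X] [NormedSpace ℝ X]
    {d : ℕ → X} (hd : DenseRange d) {g : ℕ → StrongDual ℝ X} (hg : ∀ k, ‖g k‖ = 1)
    (hgd : ∀ k, g k (d k) = ‖d k‖) {x : X} (hx : ∀ k, g k x = 0) : x = 0 := by
  rw [← norm_le_zero_iff]
  refine le_of_forall_pos_le_add fun ε hε => ?_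
  obtain ⟨k, hk⟩ := hd.exists_dist_lt x (half_pos hε)
  have h1 : |g k (x - d k)| ≤ ‖x - d k‖ := by
    simpa [hg] using (g k).le_opNorm (x - d k)
  rw [map_sub, hgd, hx] at h1
  have h2 := norm_sub_norm_le x (d k)
  rw [dist_eq_norm] at hk
  have := (abs_le.1 h1).1
  linarith

/-! ### Haar matrices -/

/-- Orthogonal matrices with a small constant column and the remaining entries of each row having
sum of absolute values less than `1 + √2`. -/
theorem exists_haar_matrix (m : ℕ) : ∃ (K H : Type) (_ : Fintype K) (_ : Fintype H)
    (_ : DecidableEq K) (_ : DecidableEq H) (A : K → Option H → ℝ),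
    Nonempty K ∧ (1 ≤ m → Nonempty H) ∧
    (∀ k l, ∑ i, A k i * A l i = if k = l then 1 else 0) ∧
    (∀ i j, ∑ k, A k i * A k j = if i = j then 1 else 0) ∧
    (∀ k, A k none = (√2)⁻¹ ^ m) ∧
    ∀ k, ∑ i : H, |A k (some i)| = (1 + √2) * (1 - (√2)⁻¹ ^ m) := by
  induction m with
  | zero =>
    refine ⟨Unit, Empty, inferInstance, inferInstance, inferInstance, inferInstance,
      fun _ _ => 1, ⟨()⟩, by simp, by simp, ?_, by simp, by simp⟩
    rintro (_ | i) (_ | j)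
    · simp
    · exact j.elim
    · exact i.elim
    · exact i.elim
  | succ m ih =>
    obtain ⟨K, H, _, _, _, _, A, ⟨k₀⟩, -, hrow, hcol, hnone, hsum⟩ := ih
    have h2 : (√2)⁻¹ * (√2)⁻¹ = 1 / 2 := by
      rw [← mul_inv, Real.mul_self_sqrt zero_le_two, one_div]
    -- Take two diagonal copies of `A` and rotate their two constant columns by 45 degrees: the
    -- normalized sum is the new constant column, the normalized difference a new Haar column.
    let B : K ⊕ K → Option (Option (H ⊕ H)) → ℝ := fun k i =>
      match k, i with
      | .inl k, none => (√2)⁻¹ * A k none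
      | .inr k, none => (√2)⁻¹ * A k none
      | .inl k, some none => (√2)⁻¹ * A k none
      | .inr k, some none => -((√2)⁻¹ * A k none)
      | .inl k, some (some (.inl i)) => A k (some i)
      | .inl _, some (some (.inr _)) => 0
      | .inr _, some (some (.inl _)) => 0
      | .inr k, some (some (.inr i)) => A k (some i)
    have hpos : 0 ≤ (√2)⁻¹ := by positivity
    have hrow' : ∀ k l, ∑ i : H, A k (some i) * A l (some i)
        = (if k = l then 1 else 0) - A k none * A l none := by
      intro k l
      rw [← hrow k l, Fintype.sum_option]; ring
    refine ⟨K ⊕ K, Option (H ⊕ H), inferInstance, inferInstance, inferInstance, inferInstance,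
      B, ⟨.inl k₀⟩, fun _ => ⟨none⟩, ?_, ?_, ?_, ?_⟩
    · rintro (k | k) (l | l)
      all_goals
        simp only [Fintype.sum_option, Fintype.sum_sum_type, B, hrow', Sum.inl.injEq, Sum.inr.injEq,
          reduceCtorEq, if_false, mul_zero, zero_mul, Finset.sum_const_zero]
        first | ring1 | linear_combination (2 * A k none * A l none) * h2
    · have e1 : ∀ a b, ∑ k, (√2)⁻¹ * A k a * ((√2)⁻¹ * A k b) = 1 / 2 * if a = b then 1 else 0 := by
        intro a b
        rw [← hcol, Finset.mul_sum, ← h2]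
        exact Finset.sum_congr rfl fun k _ => by ring
      have e2 : ∀ a b, a ≠ b → ∑ k, (√2)⁻¹ * A k a * A k b = 0 := by
        intro a b hab
        simp_rw [mul_assoc]
        rw [← Finset.mul_sum, hcol, if_neg hab, mul_zero]
      have e3 : ∀ a b, a ≠ b → ∑ k, A k a * ((√2)⁻¹ * A k b) = 0 := by
        intro a b hab
        rw [← e2 b a hab.symm]
        exact Finset.sum_congr rfl fun k _ => by ring
      rintro (_ | _ | i | i) (_ | _ | j | j)
      all_goals
        simp [Fintype.sum_sum_type, B, hcol, e1, e2, e3, -one_div, -mul_eq_mul_left_iff]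
    · rintro (k | k) <;> simp only [B, hnone, pow_succ] <;> ring
    -- Each doubling adds `(√2)⁻¹ ^ (m + 1)` to the row sum; this identity sums the geometric
    -- series.
    · have h3 : (1 + √2) * (1 - (√2)⁻¹) = (√2)⁻¹ := by
        have : √2 * (√2)⁻¹ = 1 := mul_inv_cancel₀ (by positivity)
        have h4 : √2 * √2 = 2 := Real.mul_self_sqrt zero_le_two
        field_simp
        linarith
      have hp : 0 ≤ (√2)⁻¹ ^ m := by positivity
      rintro (k | k) <;>
        simp only [Fintype.sum_option, Fintype.sum_sum_type, B, hsum, hnone, abs_neg, abs_zero,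
          Finset.sum_const_zero, abs_of_nonneg (mul_nonneg hpos hp), pow_succ] <;>
        linear_combination (-(√2)⁻¹ ^ m) * h3

/-! ### Finite biorthogonal systems and their extensions -/

namespace Biorth

section Extension

variable {X : Type*} [NormedAddCommGroup X] [NormedSpace ℝ X]

/-- The first `n` terms of `s` form a biorthogonal system. -/
def IsFinSystem (s : ℕ → X × StrongDual ℝ X) (n : ℕ) : Prop :=
  ∀ i < n, ∀ j < n, (s i).2 (s j).1 = if i = j then 1 else 0

/-- The pair `a` can be adjoined to the first `n` terms of `s`. -/
def IsExtension (s : ℕ → X × StrongDual ℝ X) (n : ℕ) (a : X × StrongDual ℝ X) : Prop :=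
  a.2 a.1 = 1 ∧ ∀ j < n, a.2 (s j).1 = 0 ∧ (s j).2 a.1 = 0

theorem isFinSystem_of_isExtension {s : ℕ → X × StrongDual ℝ X} {n : ℕ}
    (h : ∀ i < n, IsExtension s i (s i)) : IsFinSystem s n := by
  intro i hi j hj
  rcases lt_trichotomy i j with hij | rfl | hij
  · rw [if_neg hij.ne]; exact ((h j hj).2 i hij).2
  · rw [if_pos rfl]; exact (h i hi).1
  · rw [if_neg hij.ne']; exact ((h i hi).2 j hij).1

theorem isSystem_of_isExtension {s : ℕ → X × StrongDual ℝ X} (h : ∀ i, IsExtension s i (s i))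
    (i j : ℕ) : (s i).2 (s j).1 = if i = j then 1 else 0 :=
  isFinSystem_of_isExtension (n := max i j + 1) (fun i _ => h i) i
    (Nat.lt_succ_of_le (le_max_left _ _)) j (Nat.lt_succ_of_le (le_max_right _ _))

theorem IsExtension.congr {s t : ℕ → X × StrongDual ℝ X} {n : ℕ} {a : X × StrongDual ℝ X}
    (hst : ∀ j < n, s j = t j) (h : IsExtension s n a) : IsExtension t n a :=
  ⟨h.1, fun j hj => hst j hj ▸ h.2 j hj⟩

/-- The component of a vector annihilated by the functionals of a finite system. -/
noncomputable def vecRes (s : ℕ → X × StrongDual ℝ X) (n : ℕ) (u : X) : X :=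
  u - ∑ j ∈ Finset.range n, (s j).2 u • (s j).1

/-- The component of a functional annihilating the vectors of a finite system. -/
noncomputable def dualRes (s : ℕ → X × StrongDual ℝ X) (n : ℕ) (h : StrongDual ℝ X) :
    StrongDual ℝ X :=
  h - ∑ j ∈ Finset.range n, h (s j).1 • (s j).2

variable {s : ℕ → X × StrongDual ℝ X} {n : ℕ}

theorem IsFinSystem.apply_vecRes (hs : IsFinSystem s n) (u : X) {i : ℕ} (hi : i < n) :
    (s i).2 (vecRes s n u) = 0 := by
  rw [vecRes, map_sub, map_sum, Finset.sum_eq_single i]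
  · simp [hs i hi i hi]
  · intro j hj hji
    simp [hs i hi j (Finset.mem_range.1 hj), hji.symm]
  · intro h; exact absurd (Finset.mem_range.2 hi) h

/-- The two residues are adjoint, so one pairing computation serves both vectors and functionals. -/
theorem dualRes_apply (h : StrongDual ℝ X) (u : X) : dualRes s n h u = h (vecRes s n u) := by
  simp only [dualRes, vecRes, map_sub, map_sum, map_smul, smul_eq_mul,
    sub_apply, sum_apply, smul_apply]
  congr 1
  exact Finset.sum_congr rfl fun j _ => mul_comm _ _

theorem vecRes_eq_self {u : X} (hu : ∀ j < n, (s j).2 u = 0) : vecRes s n u = u := by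
  rw [vecRes, Finset.sum_eq_zero, sub_zero]
  intro j hj
  rw [hu j (Finset.mem_range.1 hj), zero_smul]

theorem IsFinSystem.dualRes_apply_eq_zero (hs : IsFinSystem s n) (h : StrongDual ℝ X) {i : ℕ}
    (hi : i < n) : dualRes s n h (s i).1 = 0 := by
  rw [dualRes_apply, vecRes, Finset.sum_eq_single i]
  · simp [hs i hi i hi]
  · intro j hj hji
    simp [hs j (Finset.mem_range.1 hj) i hi, hji]
  · intro h; exact absurd (Finset.mem_range.2 hi) h

theorem IsFinSystem.isExtension_dualRes (hs : IsFinSystem s n) {u : X} {h : StrongDual ℝ X}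
    (hu : ∀ j < n, (s j).2 u = 0) (h1 : h u = 1) : IsExtension s n (u, dualRes s n h) := by
  refine ⟨?_, fun j hj => ⟨hs.dualRes_apply_eq_zero h hj, hu j hj⟩⟩
  change dualRes s n h u = 1
  rw [dualRes_apply, vecRes_eq_self hu, h1]

theorem sub_vecRes_mem (u : X) :
    u - vecRes s n u ∈ Submodule.span ℝ ((fun j => (s j).1) '' Set.Iio n) := by
  rw [vecRes, sub_sub_cancel]
  exact Submodule.sum_mem _ fun j hj => Submodule.smul_mem _ _
    (Submodule.subset_span ⟨j, Finset.mem_range.1 hj, rfl⟩)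

theorem sub_dualRes_mem (h : StrongDual ℝ X) :
    h - dualRes s n h ∈ Submodule.span ℝ ((fun j => (s j).2) '' Set.Iio n) := by
  rw [dualRes, sub_sub_cancel]
  exact Submodule.sum_mem _ fun j hj => Submodule.smul_mem _ _
    (Submodule.subset_span ⟨j, Finset.mem_range.1 hj, rfl⟩)

/-- A finite system can be extended so that its vectors span a given vector, provided it can be
extended at all. -/
theorem IsFinSystem.exists_isExtension_vec_mem_span (hs : IsFinSystem s n)
    (hex : ∃ a, IsExtension s n a) (d : X) :
    ∃ a, IsExtension s n a ∧
      d ∈ Submodule.span ℝ (insert a.1 ((fun j => (s j).1) '' Set.Iio n)) := by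
  by_cases h0 : vecRes s n d = 0
  · obtain ⟨a, ha⟩ := hex
    refine ⟨a, ha, Submodule.span_mono (Set.subset_insert _ _) ?_⟩
    simpa [h0] using sub_vecRes_mem (s := s) (n := n) d
  · obtain ⟨h, hh⟩ := SeparatingDual.exists_eq_one (R := ℝ) h0
    refine ⟨(vecRes s n d, dualRes s n h),
      hs.isExtension_dualRes (fun j hj => hs.apply_vecRes d hj) hh, ?_⟩
    have := Submodule.add_mem _
      (Submodule.span_mono (Set.subset_insert (vecRes s n d) _) (sub_vecRes_mem (s := s) (n := n) d))
      (Submodule.subset_span (Set.mem_insert (vecRes s n d) _))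
    simpa using this

/-- A finite system can be extended so that its functionals span a given functional, provided it
can be extended at all. -/
theorem IsFinSystem.exists_isExtension_dual_mem_span (hs : IsFinSystem s n)
    (hex : ∃ a, IsExtension s n a) (g : StrongDual ℝ X) :
    ∃ a, IsExtension s n a ∧
      g ∈ Submodule.span ℝ (insert a.2 ((fun j => (s j).2) '' Set.Iio n)) := by
  by_cases h0 : dualRes s n g = 0
  · obtain ⟨a, ha⟩ := hex
    refine ⟨a, ha, Submodule.span_mono (Set.subset_insert _ _) ?_⟩
    simpa [h0] using sub_dualRes_mem (s := s) (n := n) g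
  · obtain ⟨u, hu⟩ : ∃ u, dualRes s n g u ≠ 0 := by
      by_contra! h
      exact h0 (ContinuousLinearMap.ext h)
    set v := (dualRes s n g u)⁻¹ • vecRes s n u with hv
    have hgv : g v = 1 := by
      rw [hv, map_smul, ← dualRes_apply, smul_eq_mul, inv_mul_cancel₀ hu]
    refine ⟨(v, dualRes s n g), hs.isExtension_dualRes (fun j hj => ?_) hgv, ?_⟩
    · rw [hv, map_smul, hs.apply_vecRes u hj, smul_zero]
    have := Submodule.add_mem _
      (Submodule.span_mono (Set.subset_insert (dualRes s n g) _)
        (sub_dualRes_mem (s := s) (n := n) g))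
      (Submodule.subset_span (Set.mem_insert (dualRes s n g) _))
    simpa using this

theorem tendsto_norm_dualRes_sub {f : ℕ → StrongDual ℝ X}
    (hf : ∀ x, Tendsto (fun k => f k x) atTop (𝓝 0)) :
    Tendsto (fun k => ‖dualRes s n (f k) - f k‖) atTop (𝓝 0) := by
  have h : Tendsto (fun k => ∑ j ∈ Finset.range n, f k (s j).1 • (s j).2) atTop
      (𝓝 (∑ j ∈ Finset.range n, (0 : ℝ) • (s j).2)) :=
    tendsto_finsetSum _ fun j _ => (hf (s j).1).smul_const _
  simp only [zero_smul, Finset.sum_const_zero] at h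
  simpa [dualRes] using h.norm

/-- If a functional is small on the common kernel of a finite system, it is close to the span of
the functionals of the system. -/
theorem IsFinSystem.exists_mem_span_norm_sub_le (hs : IsFinSystem s n) {f : StrongDual ℝ X} {c : ℝ}
    (hc : 0 ≤ c) (hf : ∀ u, (∀ j < n, (s j).2 u = 0) → |f u| ≤ c * ‖u‖) :
    ∃ φ ∈ Submodule.span ℝ ((fun j => (s j).2) '' Set.Iio n), ‖f - φ‖ ≤ c := by
  let N : Submodule ℝ X := ⨅ j ∈ Set.Iio n, LinearMap.ker (s j).2.toLinearMap
  have hN : ∀ u, u ∈ N ↔ ∀ j < n, (s j).2 u = 0 := by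
    intro u; simp [N, Submodule.mem_iInf]
  -- Hahn–Banach extends `f` restricted to the common kernel `N` to `g` of norm at most `c`. Then `f
  -- - g` vanishes on `N`, hence lies in the span.
  obtain ⟨g, hg, hgn⟩ := exists_extension_norm_eq N (f.comp N.subtypeL)
  have hgc : ‖g‖ ≤ c := by
    rw [hgn]
    refine ContinuousLinearMap.opNorm_le_bound _ hc fun u => ?_
    exact hf u ((hN u).1 u.2)
  refine ⟨f - g, ?_, by rwa [sub_sub_cancel]⟩
  have h0 : dualRes s n (f - g) = 0 := by
    ext u
    rw [dualRes_apply]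
    have := hg ⟨vecRes s n u, (hN _).2 fun j hj => hs.apply_vecRes u hj⟩
    change g (vecRes s n u) = f (vecRes s n u) at this
    simp [this]
  simpa [h0] using sub_dualRes_mem (s := s) (n := n) (f - g)

/-- Norm one weak-star null sequences stay at asymptotic distance at least `1 / 2` from a finite
dimensional space of functionals; this is the dual form of that fact. -/
theorem IsFinSystem.eventually_exists_vec (hs : IsFinSystem s n) {f : ℕ → StrongDual ℝ X}
    (hf1 : ∀ k, ‖f k‖ = 1) (hf : ∀ x, Tendsto (fun k => f k x) atTop (𝓝 0)) {η : ℝ} (hη : 0 < η) :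
    ∀ᶠ k in atTop, ∃ u, (∀ j < n, (s j).2 u = 0) ∧ f k u = 1 ∧ ‖u‖ ≤ 2 + η := by
  by_contra hcon
  rw [not_eventually] at hcon
  obtain ⟨k, hk, hbad⟩ := extraction_of_frequently_atTop hcon
  set c : ℝ := (2 + η)⁻¹ with hc
  have hc0 : 0 < c := by positivity
  have hc2 : c < 1 / 2 := by
    rw [hc, one_div]; gcongr; linarith
  set F := Submodule.span ℝ ((fun j => (s j).2) '' Set.Iio n) with hF
  have hdist : ∀ m, ∃ φ : F, ‖f (k m) - φ‖ ≤ c := by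
    intro m
    obtain ⟨φ, hφ, h⟩ := hs.exists_mem_span_norm_sub_le (f := f (k m)) hc0.le (fun u hu => by
      by_contra! hlt
      have h0 : f (k m) u ≠ 0 := by
        intro h0
        rw [h0, abs_zero] at hlt
        exact absurd hlt (not_lt.2 (by positivity))
      refine hbad m ⟨(f (k m) u)⁻¹ • u, fun j hj => by rw [map_smul, hu j hj, smul_zero], ?_, ?_⟩
      · rw [map_smul, smul_eq_mul, inv_mul_cancel₀ h0]
      · rw [norm_smul, norm_inv, Real.norm_eq_abs, inv_mul_le_iff₀ (abs_pos.2 h0)]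
        rw [hc, inv_mul_lt_iff₀ (by positivity)] at hlt
        linarith [mul_comm (2 + η) |f (k m) u|])
    exact ⟨⟨φ, hφ⟩, h⟩
  choose φ hφ using hdist
  have : FiniteDimensional ℝ F :=
    FiniteDimensional.span_of_finite ℝ ((Set.finite_Iio n).image _)
  have : ProperSpace F := FiniteDimensional.proper ℝ F
  have hball : ∀ m, φ m ∈ Metric.closedBall (0 : F) (1 + c) := by
    intro m
    change dist (φ m : StrongDual ℝ X) 0 ≤ 1 + c
    rw [dist_zero_right]
    have h1 := norm_sub_norm_le (φ m : StrongDual ℝ X) (f (k m))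
    rw [norm_sub_rev, hf1] at h1
    have := hφ m
    linarith
  obtain ⟨ψ, -, θ, hθ, hlim⟩ := (isCompact_closedBall (0 : F) (1 + c)).tendsto_subseq hball
  have hlim' : Tendsto (fun m => (φ (θ m) : StrongDual ℝ X)) atTop (𝓝 (ψ : StrongDual ℝ X)) :=
    (continuous_subtype_val.tendsto ψ).comp hlim
  -- The limit `ψ` of the approximants has norm at least `1 - c > 1 / 2`, while weak-star nullity of
  -- `f` forces norm at most `c < 1 / 2`.
  have hlow : 1 - c ≤ ‖(ψ : StrongDual ℝ X)‖ := by
    refine ge_of_tendsto' hlim'.norm fun m => ?_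
    have h1 := norm_sub_norm_le (f (k (θ m))) (φ (θ m))
    rw [hf1] at h1
    have := hφ (θ m)
    linarith
  have hup : ‖(ψ : StrongDual ℝ X)‖ ≤ c := by
    refine ContinuousLinearMap.opNorm_le_bound _ hc0.le fun x => ?_
    have h1 : Tendsto (fun m => ‖(φ (θ m) : StrongDual ℝ X) x‖) atTop
        (𝓝 ‖(ψ : StrongDual ℝ X) x‖) :=
      (((ContinuousLinearMap.apply ℝ ℝ x).continuous.tendsto _).comp hlim').norm
    have h2 : Tendsto (fun m => ‖f (k (θ m)) x‖ + c * ‖x‖) atTop (𝓝 (0 + c * ‖x‖)) := by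
      refine Tendsto.add_const _ ?_
      simpa using ((hf x).comp (hk.tendsto_atTop.comp hθ.tendsto_atTop)).norm
    rw [zero_add] at h2
    refine le_of_tendsto_of_tendsto' h1 h2 fun m => ?_
    have h3 := (f (k (θ m)) - φ (θ m)).le_of_opNorm_le (hφ (θ m)) x
    have h4 := norm_sub_norm_le ((φ (θ m) : StrongDual ℝ X) x) (f (k (θ m)) x)
    rw [norm_sub_rev] at h4
    simp only [sub_apply] at h3
    linarith
  linarith

theorem IsFinSystem.exists_isExtension_near (hs : IsFinSystem s n) {f : ℕ → StrongDual ℝ X}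
    (hf1 : ∀ k, ‖f k‖ = 1) (hf : ∀ x, Tendsto (fun k => f k x) atTop (𝓝 0)) {η δ : ℝ} (hη : 0 < η)
    (hδ : 0 < δ) (m : ℕ) :
    ∃ a, IsExtension s n a ∧ ‖a.1‖ ≤ 2 + η ∧ ∃ k, m ≤ k ∧ ‖a.2 - f k‖ ≤ δ := by
  obtain ⟨k, ⟨u, hu, h1, hu2⟩, hk, hkm⟩ := ((hs.eventually_exists_vec hf1 hf hη).and
    (((tendsto_norm_dualRes_sub (s := s) (n := n) hf).eventually (ge_mem_nhds hδ)).and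
      (eventually_ge_atTop m))).exists
  exact ⟨(u, dualRes s n (f k)), hs.isExtension_dualRes hu h1, hu2, k, hkm, hk⟩

/-- Extension step keeping the vectors almost normalized. The vectors `y k` almost norm `f k`
and converge weak-star to `Y` along `U`. -/
theorem IsFinSystem.exists_isExtension_near_of_tendsto (hs : IsFinSystem s n)
    {f : ℕ → StrongDual ℝ X} (hf : ∀ x, Tendsto (fun k => f k x) atTop (𝓝 0))
    {δ : ℝ} (hδ : 0 < δ) (hδ2 : δ < 1 / 2) {y : ℕ → X} (hy : ∀ k, ‖y k‖ ≤ 1)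
    (hfy : ∀ k, 1 - δ ≤ f k (y k)) {U : Filter ℕ} [U.NeBot] (hU : U ≤ atTop)
    {Y : StrongDual ℝ (StrongDual ℝ X)} (hY : ∀ h, Tendsto (fun k => h (y k)) U (𝓝 (Y h)))
    (hYf : Tendsto (fun k => Y (f k)) atTop (𝓝 0))
    (hsum : ∑ j ∈ Finset.range n, |Y (s j).2| * ‖(s j).1‖ < δ) {η : ℝ} (hη : 0 < η) (m : ℕ) :
    ∃ a, IsExtension s n a ∧ ‖a.1‖ ≤ (1 + δ) / (1 - 2 * δ) ∧
      (∑ j ∈ Finset.range n, |Y (s j).2| * ‖(s j).1‖) + |Y a.2| * ‖a.1‖ < δ ∧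
      ∃ k, m ≤ k ∧ ‖a.2 - f k‖ ≤ η ∧ ‖a.2 - f k‖ ≤ δ := by
  set σ := ∑ j ∈ Finset.range n, |Y (s j).2| * ‖(s j).1‖ with hσ
  have hnear := tendsto_norm_dualRes_sub (s := s) (n := n) hf
  have hpos : 0 < 1 - 2 * δ := by linarith
  -- Weak nullity enters here: it makes the new term of the invariant sum as small as needed.
  have hYr : Tendsto (fun k => |Y (dualRes s n (f k))| * ((1 + δ) / (1 - 2 * δ))) atTop (𝓝 0) := by
    have h1 : Tendsto (fun k => Y (dualRes s n (f k) - f k)) atTop (𝓝 0) := by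
      rw [← map_zero Y]
      exact (Y.continuous.tendsto 0).comp (tendsto_zero_iff_norm_tendsto_zero.2 hnear)
    have h2 := (h1.add hYf).abs.mul_const ((1 + δ) / (1 - 2 * δ))
    simpa using h2
  have hvec : Tendsto (fun k => ∑ j ∈ Finset.range n, |(s j).2 (y k)| * ‖(s j).1‖) U (𝓝 σ) :=
    tendsto_finsetSum _ fun j _ => (hY (s j).2).abs.mul_const _
  obtain ⟨k, ⟨hk1, hk2⟩, hk3, hk4, hk5⟩ :=
    ((((hnear.mono_left hU).eventually (ge_mem_nhds hη)).and
      ((hnear.mono_left hU).eventually (ge_mem_nhds hδ))).and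
      (((hYr.mono_left hU).eventually (gt_mem_nhds (sub_pos.2 hsum))).and
        ((hvec.eventually (gt_mem_nhds hsum)).and ((eventually_ge_atTop m).filter_mono hU)))).exists
  set h := dualRes s n (f k) with hh
  -- One `δ` is lost in `f k (y k) ≥ 1 - δ`, another in replacing `f k` by its residue.
  have hc : 1 - 2 * δ ≤ h (y k) := by
    have h1 : |(h - f k) (y k)| ≤ δ * 1 :=
      ((h - f k).le_of_opNorm_le hk2 (y k)).trans (by gcongr; exact hy k)
    rw [sub_apply] at h1
    have := (abs_le.1 h1).1
    linarith [hfy k]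
  have hc0 : 0 < h (y k) := hpos.trans_le hc
  have hv : ‖vecRes s n (y k)‖ ≤ 1 + δ := by
    refine (norm_sub_le _ _).trans (add_le_add (hy k) ?_)
    refine (norm_sum_le _ _).trans (le_trans (le_of_eq ?_) hk4.le)
    exact Finset.sum_congr rfl fun j _ => norm_smul _ _
  have hx : ‖(h (y k))⁻¹ • vecRes s n (y k)‖ ≤ (1 + δ) / (1 - 2 * δ) := by
    rw [norm_smul, norm_inv, Real.norm_eq_abs, abs_of_pos hc0, inv_mul_eq_div]
    gcongr
  refine ⟨((h (y k))⁻¹ • vecRes s n (y k), h), hs.isExtension_dualRes (fun j hj => ?_) ?_, hx, ?_,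
    k, hk5, hk1, hk2⟩
  · rw [map_smul, hs.apply_vecRes _ hj, smul_zero]
  · rw [map_smul, ← dualRes_apply, smul_eq_mul, inv_mul_cancel₀ hc0.ne']
  · have : |Y h| * ‖(h (y k))⁻¹ • vecRes s n (y k)‖ ≤ |Y h| * ((1 + δ) / (1 - 2 * δ)) := by gcongr
    change σ + |Y h| * ‖(h (y k))⁻¹ • vecRes s n (y k)‖ < δ
    linarith

end Extension

end Biorth

/-! ### Infinite systems: the `1 + ε` bound and control at even indices -/

namespace Biorth

section Construction

variable {X : Type*} [NormedAddCommGroup X] [NormedSpace ℝ X]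

/-- The lower bound comes from `1 = f n (x n) ≤ ‖f n‖ ‖x n‖`. -/
theorem semiNormalized_of_isSystem {x : ℕ → X} {f : ℕ → StrongDual ℝ X} (h : IsSystem x f)
    {C D : ℝ} (hx : ∀ n, ‖x n‖ ≤ C) (hf : ∀ n, ‖f n‖ ≤ D) : SemiNormalized f := by
  have key : ∀ n, 1 ≤ ‖f n‖ * ‖x n‖ := fun n => by
    have := (f n).le_opNorm (x n)
    rwa [h n n, if_pos rfl, norm_one] at this
  have hC : 0 < C := by
    by_contra! hC
    have h0 : ‖x 0‖ = 0 := le_antisymm ((hx 0).trans hC) (norm_nonneg _)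
    have := key 0
    rw [h0, mul_zero] at this
    linarith
  refine ⟨C⁻¹, D, by positivity, fun n => ⟨?_, hf n⟩⟩
  rw [inv_le_iff_one_le_mul₀ hC]
  exact (key n).trans (by gcongr; exact hx n)

theorem isMBounded_of_norm_le {x : ℕ → X} {f : ℕ → StrongDual ℝ X} {C D M : ℝ}
    (hx : ∀ n, ‖x n‖ ≤ C) (hf : ∀ n, ‖f n‖ ≤ D) (hM : C * D ≤ M) : IsMBounded M x f := by
  refine ⟨?_, ?_, fun n => le_trans ?_ hM⟩
  · exact (Metric.isBounded_closedBall (x := (0 : X)) (r := C)).subset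
      (Set.range_subset_iff.2 fun n => mem_closedBall_zero_iff.2 (hx n))
  · exact (Metric.isBounded_closedBall (x := (0 : StrongDual ℝ X)) (r := D)).subset
      (Set.range_subset_iff.2 fun n => mem_closedBall_zero_iff.2 (hf n))
  · exact mul_le_mul (hx n) (hf n) (norm_nonneg _) ((norm_nonneg _).trans (hx n))

theorem tendsto_apply_of_weaklyTendsto {f : ℕ → StrongDual ℝ X} (hf : WeaklyTendsto f 0) (x : X) :
    Tendsto (fun k => f k x) atTop (𝓝 0) := by
  simpa using weaklyTendsto_iff.1 hf (NormedSpace.inclusionInDoubleDual ℝ X x)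

/-- A bounded sequence converges in the weak-star topology of the bidual along an ultrafilter. -/
theorem exists_bidual_limit {y : ℕ → X} (hy : ∀ k, ‖y k‖ ≤ 1) :
    ∃ Y : StrongDual ℝ (StrongDual ℝ X),
      ∀ h : StrongDual ℝ X, Tendsto (fun k => h (y k)) (hyperfilter ℕ : Filter ℕ) (𝓝 (Y h)) := by
  let F : ℕ → WeakDual ℝ (StrongDual ℝ X) := fun k =>
    StrongDual.toWeakDual (NormedSpace.inclusionInDoubleDual ℝ X (y k))
  have hF : ∀ k, F k ∈ WeakDual.toStrongDual ⁻¹'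
      Metric.closedBall (0 : StrongDual ℝ (StrongDual ℝ X)) 1 := by
    intro k
    change NormedSpace.inclusionInDoubleDual ℝ X (y k) ∈ Metric.closedBall _ 1
    have h := (NormedSpace.double_dual_bound ℝ X (y k)).trans (hy k)
    exact (mem_closedBall_zero_iff (E := StrongDual ℝ (StrongDual ℝ X))).2 h
  obtain ⟨Y, -, hY⟩ := (WeakDual.isCompact_closedBall (0 : StrongDual ℝ (StrongDual ℝ X)) 1)
    |>.ultrafilter_le_nhds' ((hyperfilter ℕ).map F) (Ultrafilter.mem_map.2 (univ_mem' hF))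
  refine ⟨WeakDual.toStrongDual Y, fun h => ?_⟩
  exact ((WeakDual.eval_continuous h).tendsto Y).comp
    (show Tendsto F (hyperfilter ℕ : Filter ℕ) (𝓝 Y) from hY)

theorem exists_isWC0Star_isMBounded_one_add {f : ℕ → StrongDual ℝ X} (hf1 : ∀ k, ‖f k‖ = 1)
    (hf : WeaklyTendsto f 0) {ε : ℝ} (hε : 0 < ε) :
    ∃ (x : ℕ → X) (g : ℕ → StrongDual ℝ X), IsWC0Star x g ∧ IsMBounded (1 + ε) x g := by
  -- Small enough that `(1 + δ)² / (1 - 2 * δ) ≤ 1 + ε`.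
  set δ : ℝ := min (1 / 8) (ε / 8) with hδdef
  have hδ : 0 < δ := by positivity
  have hδ8 : δ ≤ 1 / 8 := min_le_left _ _
  have hδε : δ ≤ ε / 8 := min_le_right _ _
  have hy : ∀ k, ∃ y, ‖y‖ ≤ 1 ∧ 1 - δ ≤ f k y := by
    intro k
    obtain ⟨y, hy1, hy2⟩ := (f k).exists_lt_apply_of_lt_opNorm (r := 1 - δ) (by rw [hf1]; linarith)
    rw [Real.norm_eq_abs] at hy2
    rcases le_total 0 (f k y) with h | h
    · rw [abs_of_nonneg h] at hy2
      exact ⟨y, hy1.le, hy2.le⟩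
    · rw [abs_of_nonpos h] at hy2
      exact ⟨-y, by rw [norm_neg]; exact hy1.le, by rw [map_neg]; exact hy2.le⟩
  choose y hy1 hy2 using hy
  obtain ⟨Y, hY⟩ := exists_bidual_limit hy1
  -- The bound on the sum is the invariant that keeps later projections of the `y k` within `δ`, up
  -- to the limit along the ultrafilter.
  let R : ℕ → (ℕ → X × StrongDual ℝ X) → Prop := fun i s =>
    IsExtension s i (s i) ∧ ‖(s i).1‖ ≤ (1 + δ) / (1 - 2 * δ) ∧
      ∑ j ∈ Finset.range (i + 1), |Y (s j).2| * ‖(s j).1‖ < δ ∧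
      ∃ k, i ≤ k ∧ ‖(s i).2 - f k‖ ≤ 1 / ((i : ℝ) + 1) ∧ ‖(s i).2 - f k‖ ≤ δ
  obtain ⟨s, hs⟩ : ∃ s, ∀ i, R i s := by
    refine exists_seq_of_step R ?_ ?_
    · rintro i s t hst ⟨h1, h2, h3, h4⟩
      have hi := hst i le_rfl
      refine ⟨hi ▸ h1.congr fun j hj => hst j hj.le, hi ▸ h2, ?_, hi ▸ h4⟩
      convert h3 using 1
      exact Finset.sum_congr rfl fun j hj => by
        rw [hst j (Nat.lt_succ_iff.1 (Finset.mem_range.1 hj))]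
    · intro n s hs
      have hsum : ∑ j ∈ Finset.range n, |Y (s j).2| * ‖(s j).1‖ < δ := by
        cases n with
        | zero => simpa using hδ
        | succ n => exact (hs n (Nat.lt_succ_self n)).2.2.1
      obtain ⟨a, ha1, ha2, ha3, ha4⟩ :=
        (isFinSystem_of_isExtension fun i hi => (hs i hi).1).exists_isExtension_near_of_tendsto
          (tendsto_apply_of_weaklyTendsto hf) hδ (by linarith) hy1 hy2 Nat.hyperfilter_le_atTop hY
          (by simpa using weaklyTendsto_iff.1 hf Y) hsum (η := 1 / ((n : ℝ) + 1)) (by positivity) n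
      have hup : ∀ j < n, s j = Function.update s n a j := fun j hj =>
        (Function.update_of_ne hj.ne _ _).symm
      refine ⟨a, ?_⟩
      simp only [R, Function.update_self]
      refine ⟨ha1.congr hup, ha2, ?_, ha4⟩
      rw [Finset.sum_range_succ, Function.update_self]
      convert ha3 using 2
      exact Finset.sum_congr rfl fun j hj => by rw [hup j (Finset.mem_range.1 hj)]
  have hsys : IsSystem (fun n => (s n).1) (fun n => (s n).2) :=
    isSystem_of_isExtension fun i => (hs i).1
  have hnx : ∀ n, ‖(s n).1‖ ≤ (1 + δ) / (1 - 2 * δ) := fun n => (hs n).2.1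
  have hnf : ∀ n, ‖(s n).2‖ ≤ 1 + δ := by
    intro n
    obtain ⟨k, -, -, hk⟩ := (hs n).2.2.2
    have := norm_sub_norm_le (s n).2 (f k)
    rw [hf1] at this
    linarith
  refine ⟨fun n => (s n).1, fun n => (s n).2, ⟨hsys, semiNormalized_of_isSystem hsys hnx hnf, ?_⟩,
    isMBounded_of_norm_le hnx hnf ?_⟩
  · refine hf.of_norm_sub_le fun n => ?_
    obtain ⟨k, h1, h2, -⟩ := (hs n).2.2.2
    exact ⟨k, h1, h2⟩
  · rw [div_mul_eq_mul_div, div_le_iff₀ (by linarith)]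
    nlinarith

/-- Every pair of sequences of vectors and functionals is contained in the spans of a biorthogonal
system whose terms of even index have controlled norms and weakly null functionals. -/
theorem exists_system_even_controlled {f : ℕ → StrongDual ℝ X} (hf1 : ∀ k, ‖f k‖ = 1)
    (hf : WeaklyTendsto f 0) {η : ℝ} (hη : 0 < η) (d : ℕ → X) (g : ℕ → StrongDual ℝ X) :
    ∃ s : ℕ → X × StrongDual ℝ X,
      (∀ i j, (s i).2 (s j).1 = if i = j then 1 else 0) ∧
      (∀ k, ‖(s (2 * k)).1‖ ≤ 2 + η) ∧ (∀ k, ‖(s (2 * k)).2‖ ≤ 1 + η) ∧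
      WeaklyTendsto (fun k => (s (2 * k)).2) 0 ∧
      (∀ k, d k ∈ Submodule.span ℝ (Set.range fun i => (s i).1)) ∧
      ∀ k, g k ∈ Submodule.span ℝ (Set.range fun i => (s i).2) := by
  -- Even steps follow `f`, steps `1 mod 4` absorb the vectors `d`, and steps `3 mod 4` absorb the
  -- functionals `g`.
  let R : ℕ → (ℕ → X × StrongDual ℝ X) → Prop := fun i s =>
    IsExtension s i (s i) ∧
      (i % 2 = 0 → ‖(s i).1‖ ≤ 2 + η ∧
        ∃ k, i ≤ k ∧ ‖(s i).2 - f k‖ ≤ min η (1 / ((i : ℝ) + 1))) ∧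
      (i % 4 = 1 → d (i / 4) ∈ Submodule.span ℝ (insert (s i).1 ((fun j => (s j).1) '' Set.Iio i))) ∧
      (i % 4 = 3 → g (i / 4) ∈ Submodule.span ℝ (insert (s i).2 ((fun j => (s j).2) '' Set.Iio i)))
  obtain ⟨s, hs⟩ : ∃ s, ∀ i, R i s := by
    have hR : ∀ i s t, (∀ j < i, s j = t j) → s i = t i → R i s → R i t := by
      rintro i s t hst hi ⟨h1, h2, h3, h4⟩
      have e1 : (fun j => (t j).1) '' Set.Iio i = (fun j => (s j).1) '' Set.Iio i :=
        Set.image_congr fun j hj => by rw [hst j hj]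
      have e2 : (fun j => (t j).2) '' Set.Iio i = (fun j => (s j).2) '' Set.Iio i :=
        Set.image_congr fun j hj => by rw [hst j hj]
      refine ⟨hi ▸ h1.congr hst, hi ▸ h2, ?_, ?_⟩
      · rw [e1, ← hi]; exact h3
      · rw [e2, ← hi]; exact h4
    refine exists_seq_of_step R
      (fun i s t hst => hR i s t (fun j hj => hst j hj.le) (hst i le_rfl)) ?_
    intro n s hs
    have hfin : IsFinSystem s n := isFinSystem_of_isExtension fun i hi => (hs i hi).1
    obtain ⟨a, ha⟩ := hfin.exists_isExtension_near hf1 (tendsto_apply_of_weaklyTendsto hf) hη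
      (δ := min η (1 / ((n : ℝ) + 1))) (by positivity) n
    suffices h : ∃ b, IsExtension s n b ∧
        (n % 2 = 0 → ‖b.1‖ ≤ 2 + η ∧ ∃ k, n ≤ k ∧ ‖b.2 - f k‖ ≤ min η (1 / ((n : ℝ) + 1))) ∧
        (n % 4 = 1 → d (n / 4) ∈ Submodule.span ℝ (insert b.1 ((fun j => (s j).1) '' Set.Iio n))) ∧
        (n % 4 = 3 →
          g (n / 4) ∈ Submodule.span ℝ (insert b.2 ((fun j => (s j).2) '' Set.Iio n))) by
      obtain ⟨b, hb⟩ := h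
      refine ⟨b, ?_⟩
      have e1 : (fun j => (Function.update s n b j).1) '' Set.Iio n =
          (fun j => (s j).1) '' Set.Iio n :=
        Set.image_congr fun j hj => by rw [Function.update_of_ne (ne_of_lt hj)]
      have e2 : (fun j => (Function.update s n b j).2) '' Set.Iio n =
          (fun j => (s j).2) '' Set.Iio n :=
        Set.image_congr fun j hj => by rw [Function.update_of_ne (ne_of_lt hj)]
      simp only [R, Function.update_self, e1, e2]
      exact ⟨hb.1.congr fun j hj => (Function.update_of_ne hj.ne _ _).symm, hb.2⟩
    have hcases : n % 2 = 0 ∨ n % 4 = 1 ∨ n % 4 = 3 := by omega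
    rcases hcases with h | h | h
    · exact ⟨a, ha.1, fun _ => ha.2, fun _ => by omega, fun _ => by omega⟩
    · obtain ⟨b, hb1, hb2⟩ := hfin.exists_isExtension_vec_mem_span ⟨a, ha.1⟩ (d (n / 4))
      exact ⟨b, hb1, fun _ => by omega, fun _ => hb2, fun _ => by omega⟩
    · obtain ⟨b, hb1, hb2⟩ := hfin.exists_isExtension_dual_mem_span ⟨a, ha.1⟩ (g (n / 4))
      exact ⟨b, hb1, fun _ => by omega, fun _ => by omega, fun _ => hb2⟩
  refine ⟨s, isSystem_of_isExtension fun i => (hs i).1, fun k => ((hs (2 * k)).2.1 (by omega)).1,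
    fun k => ?_, hf.of_norm_sub_le fun k => ?_, fun k => ?_, fun k => ?_⟩
  · obtain ⟨l, -, hl⟩ := ((hs (2 * k)).2.1 (by omega)).2
    have h1 := norm_sub_norm_le (s (2 * k)).2 (f l)
    rw [hf1] at h1
    linarith [hl.trans (min_le_left _ _)]
  · obtain ⟨l, hl, hl'⟩ := ((hs (2 * k)).2.1 (by omega)).2
    refine ⟨l, by omega, hl'.trans ((min_le_right _ _).trans ?_)⟩
    gcongr
    linarith [Nat.cast_nonneg (α := ℝ) k]
  · have h := (hs (4 * k + 1)).2.2.1 (by omega)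
    rw [show (4 * k + 1) / 4 = k by omega] at h
    refine Submodule.span_mono ?_ h
    rintro _ (rfl | ⟨j, -, rfl⟩)
    · exact ⟨_, rfl⟩
    · exact ⟨_, rfl⟩
  · have h := (hs (4 * k + 3)).2.2.2 (by omega)
    rw [show (4 * k + 3) / 4 = k by omega] at h
    refine Submodule.span_mono ?_ h
    rintro _ (rfl | ⟨j, -, rfl⟩)
    · exact ⟨_, rfl⟩
    · exact ⟨_, rfl⟩

end Construction

end Biorth

/-! ### Mixing by orthogonal matrices and the separable case -/

namespace Biorth

section Mixing

variable {X : Type*} [NormedAddCommGroup X] [NormedSpace ℝ X]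

theorem norm_sum_option_smul_le {E H : Type*} [NormedAddCommGroup E] [NormedSpace ℝ E] [Fintype H]
    (A : Option H → ℝ) (v : Option H → E) {C S : ℝ} (hS : ∑ i, |A (some i)| ≤ S) (hC : 0 ≤ C)
    (hv : ∀ i, ‖v (some i)‖ ≤ C) :
    ‖∑ i, A i • v i‖ ≤ |A none| * ‖v none‖ + S * C := by
  rw [Fintype.sum_option]
  refine (norm_add_le _ _).trans (add_le_add (norm_smul _ _).le ?_)
  calc ‖∑ i, A (some i) • v (some i)‖ ≤ ∑ i, |A (some i)| * C :=
        norm_sum_le_of_le _ fun i _ => by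
          rw [norm_smul, Real.norm_eq_abs]; gcongr; exact hv i
    _ = (∑ i, |A (some i)|) * C := (Finset.sum_mul _ _ _).symm
    _ ≤ S * C := by gcongr

/-- Each term of odd index of a biorthogonal system is mixed with finitely many terms of even
index by means of an orthogonal matrix; the resulting system has the same spans and inherits
boundedness and weak nullity from the terms of even index. -/
theorem exists_mixed_system {K H : ℕ → Type} [∀ j, Fintype (K j)] [∀ j, Fintype (H j)]
    [∀ j, DecidableEq (K j)] [∀ j, DecidableEq (H j)] [∀ j, Nonempty (K j)] [∀ j, Nonempty (H j)]
    (A : ∀ j, K j → Option (H j) → ℝ)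
    (hrow : ∀ j k l, ∑ i, A j k i * A j l i = if k = l then 1 else 0)
    (hcol : ∀ j i i', ∑ k, A j k i * A j k i' = if i = i' then 1 else 0) {S : ℝ} (hS : 0 < S)
    (hsum : ∀ j k, ∑ i, |A j k (some i)| ≤ S)
    {s : ℕ → X × StrongDual ℝ X} (hs : ∀ i j, (s i).2 (s j).1 = if i = j then 1 else 0)
    {C D η : ℝ} (hC : 0 ≤ C) (hD : 0 ≤ D) (hη : 0 < η) (hsC : ∀ k, ‖(s (2 * k)).1‖ ≤ C)
    (hsD : ∀ k, ‖(s (2 * k)).2‖ ≤ D) (hw : WeaklyTendsto (fun k => (s (2 * k)).2) 0)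
    (hA1 : ∀ j k, |A j k none| * ‖(s (2 * j + 1)).1‖ ≤ η / ((j : ℝ) + 1))
    (hA2 : ∀ j k, |A j k none| * ‖(s (2 * j + 1)).2‖ ≤ η / ((j : ℝ) + 1)) :
    ∃ (x : ℕ → X) (f : ℕ → StrongDual ℝ X), IsSystem x f ∧ WeaklyTendsto f 0 ∧
      (∀ n, ‖x n‖ ≤ η + S * C) ∧ (∀ n, ‖f n‖ ≤ η + S * D) ∧
      (∀ i, (s i).1 ∈ Submodule.span ℝ (Set.range x)) ∧
      ∀ i, (s i).2 ∈ Submodule.span ℝ (Set.range f) := by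
  have : Infinite (Σ j, H j) :=
    Infinite.of_surjective Sigma.fst fun j => ⟨⟨j, Classical.arbitrary _⟩, rfl⟩
  have : Infinite (Σ j, K j) :=
    Infinite.of_surjective Sigma.fst fun j => ⟨⟨j, Classical.arbitrary _⟩, rfl⟩
  obtain ⟨e⟩ : Nonempty ((Σ j, H j) ≃ ℕ) := nonempty_equiv_of_countable
  obtain ⟨r⟩ : Nonempty ((Σ j, K j) ≃ ℕ) := nonempty_equiv_of_countable
  -- Block `j` consists of the odd index `2 * j + 1` and the even indices assigned to `H j`; through
  -- `e` the blocks partition `ℕ`.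
  let ι : ∀ j, Option (H j) → ℕ := fun j i => i.elim (2 * j + 1) fun h => 2 * e ⟨j, h⟩
  have hι : ∀ j i j' i', ι j i = ι j' i' → (⟨j, i⟩ : Σ j, Option (H j)) = ⟨j', i'⟩ := by
    rintro j (_ | h) j' (_ | h') heq <;> simp only [ι, Option.elim_none, Option.elim_some] at heq
    · obtain rfl : j = j' := by omega
      rfl
    · omega
    · omega
    · have h1 : e ⟨j, h⟩ = e ⟨j', h'⟩ := by omega
      have h2 := e.injective h1
      cases h2
      rfl
  have hιsurj : ∀ n, ∃ j i, ι j i = n := by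
    intro n
    rcases Nat.even_or_odd' n with ⟨m, rfl | rfl⟩
    · exact ⟨(e.symm m).1, some (e.symm m).2, by simp [ι]⟩
    · exact ⟨m, none, rfl⟩
  let x : (Σ j, K j) → X := fun p => ∑ i, A p.1 p.2 i • (s (ι p.1 i)).1
  let f : (Σ j, K j) → StrongDual ℝ X := fun p => ∑ i, A p.1 p.2 i • (s (ι p.1 i)).2
  have hη' : ∀ j : ℕ, η / ((j : ℝ) + 1) ≤ η := fun j =>
    div_le_self hη.le (by linarith [Nat.cast_nonneg (α := ℝ) j])
  have hxn : ∀ p, ‖x p‖ ≤ η + S * C := fun p =>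
    (norm_sum_option_smul_le (A p.1 p.2) (fun i => (s (ι p.1 i)).1) (hsum p.1 p.2) hC
      fun i => hsC _).trans (by gcongr; exact (hA1 p.1 p.2).trans (hη' _))
  have hfn : ∀ p, ‖f p‖ ≤ η + S * D := fun p =>
    (norm_sum_option_smul_le (A p.1 p.2) (fun i => (s (ι p.1 i)).2) (hsum p.1 p.2) hD
      fun i => hsD _).trans (by gcongr; exact (hA2 p.1 p.2).trans (hη' _))
  have hbi : ∀ p q, f p (x q) = if p = q then 1 else 0 := by
    rintro ⟨j, k⟩ ⟨j', k'⟩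
    have h1 : f ⟨j, k⟩ (x ⟨j', k'⟩) =
        ∑ i, ∑ i', A j k i * (A j' k' i' * if ι j i = ι j' i' then 1 else 0) := by
      simp only [f, x, map_sum, map_smul, smul_eq_mul, sum_apply, smul_apply, hs, Finset.mul_sum]
      rw [Finset.sum_comm]
      exact Finset.sum_congr rfl fun i _ => Finset.sum_congr rfl fun i' _ => by ring
    rw [h1]
    by_cases hj : j = j'
    · subst hj
      have h2 : ∀ i i', ι j i = ι j i' ↔ i = i' := fun i i' =>
        ⟨fun h => by simpa using hι j i j i' h, fun h => by rw [h]⟩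
      simp [h2, hrow]
    · rw [if_neg fun h => hj (congrArg Sigma.fst h)]
      refine Finset.sum_eq_zero fun i _ => Finset.sum_eq_zero fun i' _ => ?_
      rw [if_neg fun h => hj (congrArg Sigma.fst (hι j i j' i' h)), mul_zero, mul_zero]
  -- Column orthogonality inverts the mixing within a block, so the spans are recovered.
  have hrec : ∀ {E : Type _} [AddCommGroup E] [Module ℝ E] (j : ℕ) (v : Option (H j) → E)
      (i : Option (H j)), v i = ∑ k, A j k i • ∑ i', A j k i' • v i' := by
    intro E _ _ j v i
    simp only [Finset.smul_sum, smul_smul]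
    rw [Finset.sum_comm]
    simp only [← Finset.sum_smul, hcol]
    simp
  -- The enumeration `r` of the rows is arbitrary, so the limit is taken along `cofinite`. All but
  -- finitely many rows lie in blocks whose even indices are large and whose odd term contributes at
  -- most `‖φ‖ * η / (j + 1)`.
  have hwk : ∀ φ : StrongDual ℝ (StrongDual ℝ X),
      Tendsto (fun p => φ (f p)) cofinite (𝓝 0) := by
    intro φ
    rw [Metric.tendsto_nhds]
    intro ε hε
    have h1 := (weaklyTendsto_iff.1 hw φ)
    rw [map_zero, Metric.tendsto_nhds] at h1
    obtain ⟨N, hN⟩ := eventually_atTop.1 (h1 (ε / (2 * S)) (by positivity))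
    have h2 : Tendsto (fun j : ℕ => ‖φ‖ * (η * (1 / ((j : ℝ) + 1)))) atTop (𝓝 0) := by
      simpa using (tendsto_one_div_add_atTop_nhds_zero_nat (𝕜 := ℝ)).const_mul η |>.const_mul ‖φ‖
    obtain ⟨N', hN'⟩ := eventually_atTop.1 (h2.eventually (gt_mem_nhds (half_pos hε)))
    obtain ⟨M, hM⟩ : ∃ M, ∀ n < N, (e.symm n).1 < M :=
      ⟨(Finset.range N).sup (fun n => (e.symm n).1) + 1, fun n hn => Nat.lt_succ_of_le
        (Finset.le_sup (f := fun n => (e.symm n).1) (Finset.mem_range.2 hn))⟩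
    have hfin : {p : Σ j, K j | p.1 < max M N'}.Finite := by
      refine (((Finset.range (max M N')).sigma fun j =>
        (Finset.univ : Finset (K j))).finite_toSet).subset fun p hp => ?_
      simpa using hp
    filter_upwards [hfin.compl_mem_cofinite] with p hp
    have hp' : max M N' ≤ p.1 := not_lt.1 hp
    have h3 : ∀ i, ‖φ (s (ι p.1 (some i))).2‖ ≤ ε / (2 * S) := by
      intro i
      have : N ≤ e ⟨p.1, i⟩ := by
        by_contra! hlt
        have := hM _ hlt
        rw [e.symm_apply_apply] at this
        exact absurd this (not_lt.2 ((le_max_left _ _).trans hp'))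
      rw [← dist_zero_right]
      exact (hN _ this).le
    have h4 := norm_sum_option_smul_le (A p.1 p.2) (fun i => φ (s (ι p.1 i)).2) (hsum p.1 p.2)
      (by positivity) h3
    have h5 : φ (f p) = ∑ i, A p.1 p.2 i • φ (s (ι p.1 i)).2 := by simp [f]
    have h6 : |A p.1 p.2 none| * ‖φ (s (ι p.1 none)).2‖ ≤ ‖φ‖ * (η * (1 / ((p.1 : ℝ) + 1))) := by
      calc |A p.1 p.2 none| * ‖φ (s (ι p.1 none)).2‖
          ≤ |A p.1 p.2 none| * (‖φ‖ * ‖(s (2 * p.1 + 1)).2‖) := by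
            gcongr; exact φ.le_opNorm _
        _ = ‖φ‖ * (|A p.1 p.2 none| * ‖(s (2 * p.1 + 1)).2‖) := by ring
        _ ≤ ‖φ‖ * (η * (1 / ((p.1 : ℝ) + 1))) := by
            rw [mul_one_div]
            exact mul_le_mul_of_nonneg_left (hA2 _ _) φ.opNorm_nonneg
    have h7 := hN' p.1 ((le_max_right _ _).trans hp')
    have h8 : S * (ε / (2 * S)) = ε / 2 := by field_simp
    rw [dist_zero_right, h5]
    linarith
  refine ⟨x ∘ r.symm, f ∘ r.symm, fun n m => ?_, weaklyTendsto_iff.2 fun φ => ?_,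
    fun n => hxn _, fun n => hfn _, fun n => ?_, fun n => ?_⟩
  · simp [hbi]
  · rw [map_zero, ← Nat.cofinite_eq_atTop]
    exact (hwk φ).comp r.symm.injective.tendsto_cofinite
  · obtain ⟨j, i, rfl⟩ := hιsurj n
    rw [hrec j (fun i => (s (ι j i)).1) i]
    exact Submodule.sum_mem _ fun k _ => Submodule.smul_mem _ _
      (Submodule.subset_span ⟨r ⟨j, k⟩, congrArg x (r.symm_apply_apply _)⟩)
  · obtain ⟨j, i, rfl⟩ := hιsurj n
    rw [hrec j (fun i => (s (ι j i)).2) i]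
    exact Submodule.sum_mem _ fun k _ => Submodule.smul_mem _ _
      (Submodule.subset_span ⟨r ⟨j, k⟩, congrArg f (r.symm_apply_apply _)⟩)

/-- A biorthogonal system with controlled terms of even index can be replaced by a bounded one
with the same spans. -/
theorem exists_bounded_system_of_even_controlled {s : ℕ → X × StrongDual ℝ X}
    (hs : ∀ i j, (s i).2 (s j).1 = if i = j then 1 else 0)
    {C D η : ℝ} (hC : 0 ≤ C) (hD : 0 ≤ D) (hη : 0 < η) (hsC : ∀ k, ‖(s (2 * k)).1‖ ≤ C)
    (hsD : ∀ k, ‖(s (2 * k)).2‖ ≤ D) (hw : WeaklyTendsto (fun k => (s (2 * k)).2) 0) :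
    ∃ (x : ℕ → X) (f : ℕ → StrongDual ℝ X), IsSystem x f ∧ WeaklyTendsto f 0 ∧
      (∀ n, ‖x n‖ ≤ η + (1 + √2) * C) ∧ (∀ n, ‖f n‖ ≤ η + (1 + √2) * D) ∧
      (∀ i, (s i).1 ∈ Submodule.span ℝ (Set.range x)) ∧
      ∀ i, (s i).2 ∈ Submodule.span ℝ (Set.range f) := by
  have hq0 : 0 < (√2)⁻¹ := by positivity
  have hq1 : (√2)⁻¹ < 1 := inv_lt_one_of_one_lt₀ (by
    rw [Real.lt_sqrt zero_le_one]; norm_num)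
  -- The condition `1 ≤ m` makes every block contain an even term, so that infinitely many even
  -- slots match all even indices.
  have hm : ∀ j : ℕ, ∃ m : ℕ, 1 ≤ m ∧
      (√2)⁻¹ ^ m * (‖(s (2 * j + 1)).1‖ + ‖(s (2 * j + 1)).2‖) ≤ η / ((j : ℝ) + 1) := by
    intro j
    have h : Tendsto (fun m : ℕ => (√2)⁻¹ ^ m * (‖(s (2 * j + 1)).1‖ + ‖(s (2 * j + 1)).2‖)) atTop
        (𝓝 0) := by
      simpa using (tendsto_pow_atTop_nhds_zero_of_lt_one hq0.le hq1).mul_const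
        (‖(s (2 * j + 1)).1‖ + ‖(s (2 * j + 1)).2‖)
    exact ((eventually_ge_atTop 1).and (h.eventually (ge_mem_nhds (by positivity)))).exists
  choose m hm1 hm2 using hm
  choose K H _ _ _ _ A hK hH hrow hcol hnone hsum using fun j => exists_haar_matrix (m j)
  have : ∀ j, Nonempty (H j) := fun j => hH j (hm1 j)
  have habs : ∀ j k, |A j k none| = (√2)⁻¹ ^ m j := fun j k => by
    rw [hnone, abs_of_nonneg (by positivity)]
  refine exists_mixed_system A hrow hcol (S := 1 + √2) (by positivity) (fun j k => ?_) hs hC hD hη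
    hsC hsD hw (fun j k => ?_) (fun j k => ?_)
  · rw [hsum]
    refine mul_le_of_le_one_right (by positivity) ?_
    have : 0 ≤ (√2)⁻¹ ^ m j := by positivity
    linarith
  · rw [habs]
    refine le_trans ?_ (hm2 j)
    gcongr
    exact le_add_of_nonneg_right (norm_nonneg _)
  · rw [habs]
    refine le_trans ?_ (hm2 j)
    gcongr
    exact le_add_of_nonneg_left (norm_nonneg _)

/-- A dense sequence inside the span of the vectors gives fundamentality; norm-one functionals
attaining the norms of its terms, inside the span of the functionals, give both totality and
norming. -/
theorem exists_fundamental_total_system [TopologicalSpace.SeparableSpace X]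
    {f : ℕ → StrongDual ℝ X} (hf1 : ∀ k, ‖f k‖ = 1) (hf : WeaklyTendsto f 0) {ε : ℝ} (hε : 0 < ε) :
    ∃ (x : ℕ → X) (g : ℕ → StrongDual ℝ X), IsWC0Star x g ∧
      IsMBounded (2 * (1 + √2) ^ 2 + ε) x g ∧ IsFundamentalSet (Set.range x) ∧
      IsTotalSet (Set.range g) ∧
      Norms ((Submodule.span ℝ (Set.range g)).topologicalClosure : Set (StrongDual ℝ X))
        Set.univ := by
  have : Nontrivial X := by
    by_contra h
    rw [not_nontrivial_iff_subsingleton] at h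
    have h0 : f 0 = 0 := Subsingleton.elim _ _
    simpa [h0] using hf1 0
  obtain ⟨d, hd⟩ := TopologicalSpace.exists_dense_seq X
  choose g hg1 hg using fun k => exists_dual_vector' ℝ (d k)
  obtain ⟨η, hη, hηε⟩ : ∃ η : ℝ, 0 < η ∧
      (η + (1 + √2) * (2 + η)) * (η + (1 + √2) * (1 + η)) ≤ 2 * (1 + √2) ^ 2 + ε := by
    have hcont : Tendsto (fun η : ℝ => (η + (1 + √2) * (2 + η)) * (η + (1 + √2) * (1 + η)))
        (𝓝[>] 0) (𝓝 (2 * (1 + √2) ^ 2)) := by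
      have h : Continuous fun η : ℝ => (η + (1 + √2) * (2 + η)) * (η + (1 + √2) * (1 + η)) := by
        fun_prop
      convert (h.tendsto 0).mono_left nhdsWithin_le_nhds using 2
      ring
    exact ((eventually_mem_nhdsWithin (a := (0 : ℝ)) (s := Set.Ioi 0)).and
      (hcont.eventually (ge_mem_nhds (by linarith)))).exists
  obtain ⟨s, hs, hsC, hsD, hw, hsd, hsg⟩ := exists_system_even_controlled hf1 hf hη d g
  obtain ⟨x, h, hsys, hweak, hxn, hhn, hx, hh⟩ := exists_bounded_system_of_even_controlled hs
    (by positivity) (by positivity) hη hsC hsD hw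
  have hxd : ∀ k, d k ∈ Submodule.span ℝ (Set.range x) := fun k =>
    Submodule.span_le.2 (Set.range_subset_iff.2 hx) (hsd k)
  have hhg : ∀ k, g k ∈ Submodule.span ℝ (Set.range h) := fun k =>
    Submodule.span_le.2 (Set.range_subset_iff.2 hh) (hsg k)
  refine ⟨x, h, ⟨hsys, semiNormalized_of_isSystem hsys hxn hhn, hweak⟩,
    isMBounded_of_norm_le hxn hhn hηε, ?_, isTotalSet_of_separating fun y hy => ?_, ?_⟩
  · rw [IsFundamentalSet, ← Submodule.dense_iff_topologicalClosure_eq_top]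
    exact hd.mono (Set.range_subset_iff.2 hxd)
  · refine eq_zero_of_norm_one_sequence hd hg1 hg fun k => ?_
    have hle : Submodule.span ℝ (Set.range h) ≤
        LinearMap.ker (NormedSpace.inclusionInDoubleDual ℝ X y).toLinearMap :=
      Submodule.span_le.2 fun z hz => hy z hz
    exact hle (hhg k)
  · exact norms_of_norm_one_sequence hd hg1 hg fun k => Submodule.le_topologicalClosure _ (hhg k)

end Mixing

end Biorth

/-! ### The equivalences and the quantitative statements -/

theorem theorem3p1 (X : Type*) [NormedAddCommGroup X] [NormedSpace ℝ X] [CompleteSpace X] :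
    (¬ SchurProperty (StrongDual ℝ X) ↔ Biorth.HasBoundedWC0Star X) ∧
    (Biorth.HasBoundedWC0Star X → ∀ ε : ℝ, 0 < ε →
      ∃ (x : ℕ → X) (f : ℕ → StrongDual ℝ X),
        Biorth.IsWC0Star x f ∧ Biorth.IsMBounded (1 + ε) x f) ∧
    (TopologicalSpace.SeparableSpace X →
      [¬ SchurProperty (StrongDual ℝ X), Biorth.HasBoundedWC0Star X,
        Biorth.HasBoundedFTWC0Star X].TFAE ∧
      (Biorth.HasBoundedFTWC0Star X → ∀ ε : ℝ, 0 < ε →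
        ∃ (x : ℕ → X) (f : ℕ → StrongDual ℝ X),
          Biorth.IsWC0Star x f ∧
          Biorth.IsMBounded (2 * (1 + √2) ^ 2 + ε) x f ∧
          IsFundamentalSet (Set.range x) ∧ IsTotalSet (Set.range f) ∧
          Norms ((Submodule.span ℝ (Set.range f)).topologicalClosure : Set (StrongDual ℝ X))
            Set.univ)) := by
  have hba : Biorth.HasBoundedWC0Star X → ¬ SchurProperty (StrongDual ℝ X) := by
    rintro ⟨x, f, hf, -⟩
    exact not_schurProperty_of_semiNormalized hf.2.1 hf.2.2
  have hb : ¬ SchurProperty (StrongDual ℝ X) → ∀ ε : ℝ, 0 < ε →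
      ∃ (x : ℕ → X) (f : ℕ → StrongDual ℝ X),
        Biorth.IsWC0Star x f ∧ Biorth.IsMBounded (1 + ε) x f := by
    intro h ε hε
    obtain ⟨f, hf1, hf⟩ := exists_normalized_weaklyTendsto_zero_of_not_schurProperty h
    exact Biorth.exists_isWC0Star_isMBounded_one_add hf1 hf hε
  have hab : ¬ SchurProperty (StrongDual ℝ X) → Biorth.HasBoundedWC0Star X := by
    intro h
    obtain ⟨x, f, hf, hM⟩ := hb h 1 one_pos
    exact ⟨x, f, hf, _, hM⟩
  have hcb : Biorth.HasBoundedFTWC0Star X → Biorth.HasBoundedWC0Star X := by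
    rintro ⟨x, f, hf, hM, -⟩
    exact ⟨x, f, hf, hM⟩
  refine ⟨⟨hab, hba⟩, fun h => hb (hba h), fun hsep => ?_⟩
  have hc : ¬ SchurProperty (StrongDual ℝ X) → ∀ ε : ℝ, 0 < ε →
      ∃ (x : ℕ → X) (f : ℕ → StrongDual ℝ X), Biorth.IsWC0Star x f ∧
        Biorth.IsMBounded (2 * (1 + √2) ^ 2 + ε) x f ∧
        IsFundamentalSet (Set.range x) ∧ IsTotalSet (Set.range f) ∧
        Norms ((Submodule.span ℝ (Set.range f)).topologicalClosure : Set (StrongDual ℝ X))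
          Set.univ := by
    intro h ε hε
    obtain ⟨f, hf1, hf⟩ := exists_normalized_weaklyTendsto_zero_of_not_schurProperty h
    exact Biorth.exists_fundamental_total_system hf1 hf hε
  refine ⟨?_, fun h => hc (hba (hcb h))⟩
  tfae_have 1 → 3 := by
    intro h
    obtain ⟨x, f, hf, hM, hfund, htot, -⟩ := hc h 1 one_pos
    exact ⟨x, f, hf, ⟨_, hM⟩, hfund, htot⟩
  tfae_have 3 → 2 := hcb
  tfae_have 2 → 1 := hba
  tfae_finish
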